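/- A BWR-game $\mathcal G$ consists of a finite digraph (loops and parallel arcs allowed) in which every position has an outgoing arc, a partition of the positions into white, black and random ones, positive transition probabilities on the arcs leaving each random position that sum to $1$, and a real local reward $r(e)$ on every arc $e$. A BW-game is a BWR-game without random positions. White (the maximizer) and Black (the minimizer) choose pure stationary strategies, that is, one outgoing arc at each position they own; the payoff of a pair of strategies from the initial position $v$ is the limiting mean payoff $\liminf_{T\to\infty}\frac1{T+1}\sum_{i=0}^{T}\mathbb E[r(e_i)]$, where $e_0,e_1,\dots$ are the arcs of the play started at $v$. A pair of strategies is uniformly optimal if it is a saddle point of the payoff for all initial positions simultaneously; the value $\mu(v)$ is the payoff of a uniformly optimal pair from $v$. Let $\mathcal G$ be a BWR-game and let $Y$ be a set of positions such that every white or black position in $Y$ has an arc ending in $Y$. For $x\in\mathbb R$, the parametrized BW-game $\widehat{\mathcal G}(x)=\widehat{\mathcal G[Y]}(x)$ is obtained from $\mathcal G$ by deleting all positions outside $Y$ and all arcs not inside $Y$, deleting all arcs leaving random positions, and contracting the random positions in $Y$ into one deterministic position $w$ (white or black, arbitrarily; $w$ is present also if $Y$ has no random position) with a self-loop $(w,w)$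 of local reward $x$. Corollary. Let $v$ be a position of the parametrized BW-game. For every $x\in\mathbb R$ the game $\widehat{\mathcal G}(x)$ has a uniformly optimal pair of pure stationary strategies, and there are $\lambda_1(v)\le\lambda_2(v)$ in $\mathbb R\cup\{-\infty,+\infty\}$, not depending on $x$, such that for every $x\in\mathbb R$: (i) $\mu_{\widehat{\mathcal G}(x)}(v)=\lambda_2(v)$ if $x\ge\lambda_2(v)$; (ii) $\mu_{\widehat{\mathcal G}(x)}(v)=\lambda_1(v)$ if $x\le\lambda_1(v)$; (iii) $\mu_{\widehat{\mathcal G}(x)}(v)=x$ if $\lambda_1(v)\le x\le\lambda_2(v)$. Moreover, if $R\ge 0$ and $|r(e)|\le R$ for every arc $e$ of $\mathcal G$, then there are real numbers $\lambda_1(v)\le\lambda_2(v)$ in $[-R,R]$ such that (i), (ii) and (iii) hold for every $x\in[-R,R]$. -/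

import Mathlib

/-- The three kinds of positions: `white` belongs to the maximizer, `black` to the minimizer,
and at `random` positions the move is made by chance. -/
inductive BWROwner
  | white
  | black
  | random

open Classical in
/-- A BWR-game with positions `V` and arcs `E`. Loops and parallel arcs are allowed, and every
position has an outgoing arc. The number `prob e` is only meaningful for arcs leaving a random
position. -/
structure BWRGame (V E : Type*) [Fintype E] where
  owner : V → BWROwner
  src : E → V
  tgt : E → V
  prob : E → ℝ
  reward : E → ℝ
  exists_arc : ∀ v, ∃ e, src e = v
  prob_pos : ∀ e, owner (src e) = BWROwner.random → 0 < prob e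
  prob_sum : ∀ v, owner v = BWROwner.random → ∑ e with src e = v, prob e = 1

namespace BWRGame

section Basic

variable {V E : Type*} [Fintype E] (G : BWRGame V E)

/-- A BW-game is a BWR-game without random positions. -/
def IsBW : Prop := ∀ v, G.owner v ≠ BWROwner.random

/-- Pure stationary strategies of White: one outgoing arc for each white position. -/
abbrev WhiteStrategy : Type _ :=
  (v : {v : V // G.owner v = BWROwner.white}) → {e : E // G.src e = v.1}

/-- Pure stationary strategies of Black: one outgoing arc for each black position. -/
abbrev BlackStrategy : Type _ :=
  (v : {v : V // G.owner v = BWROwner.black}) → {e : E // G.src e = v.1}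

open Classical in
/-- The probability that the arc `e` is taken when the play is at `G.src e`, in the situation
`(sW, sB)`. -/
noncomputable def arcProb (sW : G.WhiteStrategy) (sB : G.BlackStrategy) (e : E) : ℝ :=
  if hw : G.owner (G.src e) = BWROwner.white then
    if (sW ⟨G.src e, hw⟩).1 = e then 1 else 0
  else if hb : G.owner (G.src e) = BWROwner.black then
    if (sB ⟨G.src e, hb⟩).1 = e then 1 else 0
  else G.prob e

open Classical in
/-- The transition matrix of the Markov chain defined by a situation. -/
noncomputable def transition (sW : G.WhiteStrategy) (sB : G.BlackStrategy) : Matrix V V ℝ :=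
  fun v u => ∑ e with G.src e = v ∧ G.tgt e = u, G.arcProb sW sB e

open Classical in
/-- The expected local reward of one step from `v` in a situation. -/
noncomputable def stepReward (sW : G.WhiteStrategy) (sB : G.BlackStrategy) (v : V) : ℝ :=
  ∑ e with G.src e = v, G.arcProb sW sB e * G.reward e

variable [Fintype V]

open Classical in
/-- The expected reward incurred at step `i` of the play that starts at `v`. -/
noncomputable def expectedReward (sW : G.WhiteStrategy) (sB : G.BlackStrategy) (v : V)
    (i : ℕ) : ℝ :=
  Matrix.mulVec (G.transition sW sB ^ i) (G.stepReward sW sB) v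

/-- The limiting mean payoff of a situation for the initial position `v`:
the lower limit of `(∑_{i = 0}^T E[r(e_i)]) / (T + 1)`. -/
noncomputable def payoff (sW : G.WhiteStrategy) (sB : G.BlackStrategy) (v : V) : ℝ :=
  Filter.liminf
    (fun T : ℕ => (∑ i ∈ Finset.range (T + 1), G.expectedReward sW sB v i) / ((T : ℝ) + 1))
    Filter.atTop

/-- The situation `(sW, sB)` is uniformly optimal: it is a saddle point among the pure stationary
strategies simultaneously for all initial positions. -/
def IsUniformlyOptimal (sW : G.WhiteStrategy) (sB : G.BlackStrategy) : Prop :=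
  ∀ (tW : G.WhiteStrategy) (tB : G.BlackStrategy) (v : V),
    G.payoff tW sB v ≤ G.payoff sW sB v ∧ G.payoff sW sB v ≤ G.payoff sW tB v

/-- The game has a pair of uniformly optimal pure stationary strategies, and its value from
the initial position `v` is `m`. -/
def HasValue (v : V) (m : ℝ) : Prop :=
  ∃ (sW : G.WhiteStrategy) (sB : G.BlackStrategy),
    G.IsUniformlyOptimal sW sB ∧ G.payoff sW sB v = m

variable {G} in
/-- The value is unique. -/
theorem HasValue.unique {v : V} {m m' : ℝ} (h : G.HasValue v m) (h' : G.HasValue v m') :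
    m = m' := by
  obtain ⟨sW, sB, hs, rfl⟩ := h
  obtain ⟨tW, tB, ht, rfl⟩ := h'
  exact le_antisymm ((hs sW tB v).2.trans (ht sW tB v).1) ((ht tW sB v).2.trans (hs tW sB v).1)

end Basic

section Parametrized

variable {V E : Type*} [Fintype E] (G : BWRGame V E) (Y : Set V)

/-- Positions of the parametrized BW-game: the deterministic positions in `Y`, and the
position `w = none` into which the random positions in `Y` are contracted. -/
def HatPos : Type _ := Option {v : V // v ∈ Y ∧ G.owner v ≠ BWROwner.random}

/-- Arcs of the parametrized BW-game: the arcs inside `Y` leaving deterministic positions,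
and the self-loop `none` at `w`. -/
def HatArc : Type _ :=
  Option {e : E // (G.src e ∈ Y ∧ G.owner (G.src e) ≠ BWROwner.random) ∧ G.tgt e ∈ Y}

open Classical in
noncomputable instance [Fintype V] : Fintype (G.HatPos Y) :=
  inferInstanceAs (Fintype (Option {v : V // v ∈ Y ∧ G.owner v ≠ BWROwner.random}))

open Classical in
noncomputable instance : Fintype (G.HatArc Y) :=
  inferInstanceAs (Fintype
    (Option {e : E // (G.src e ∈ Y ∧ G.owner (G.src e) ≠ BWROwner.random) ∧ G.tgt e ∈ Y}))

/-- The owner of a position of the parametrized BW-game; `c` says whether `w` is white. -/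
def hatOwner (c : Bool) : G.HatPos Y → BWROwner
  | none => if c then BWROwner.white else BWROwner.black
  | some v => G.owner v.1

/-- The initial position of an arc of the parametrized BW-game. -/
def hatSrc : G.HatArc Y → G.HatPos Y
  | none => none
  | some e => some ⟨G.src e.1, e.2.1⟩

open Classical in
/-- The end of an arc of the parametrized BW-game: an arc that enters a random position of `Y`
now enters `w`. -/
noncomputable def hatTgt : G.HatArc Y → G.HatPos Y
  | none => none
  | some e =>
    if h : G.owner (G.tgt e.1) = BWROwner.random then none
    else some ⟨G.tgt e.1, e.2.2, h⟩

/-- The local rewards of the parametrized BW-game: `x` on the self-loop at `w`. -/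
def hatReward (x : ℝ) : G.HatArc Y → ℝ
  | none => x
  | some e => G.reward e.1

theorem hatOwner_ne_random (c : Bool) (v : G.HatPos Y) :
    G.hatOwner Y c v ≠ BWROwner.random := by
  cases v with
  | none => cases c <;> simp [hatOwner]
  | some v => exact v.2.2

/-- The parametrized BW-game with parameter `x`, obtained from `G` and a set `Y` of positions
that no player is forced to leave: all positions outside `Y` and all arcs that are not inside
`Y` are deleted, the arcs leaving random positions are deleted, and the random positions are
contracted into one deterministic position `w` with a self-loop of local reward `x`.
Whether `w` is white (`c = true`) or black is arbitrary. -/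
noncomputable def hat
    (hY : ∀ v ∈ Y, G.owner v ≠ BWROwner.random → ∃ e, G.src e = v ∧ G.tgt e ∈ Y)
    (c : Bool) (x : ℝ) : BWRGame (G.HatPos Y) (G.HatArc Y) where
  owner := G.hatOwner Y c
  src := G.hatSrc Y
  tgt := G.hatTgt Y
  prob := fun _ => 0
  reward := G.hatReward Y x
  exists_arc := by
    intro v
    cases v with
    | none => exact ⟨none, rfl⟩
    | some v =>
      obtain ⟨v, hv, hr⟩ := v
      obtain ⟨e, rfl, ht⟩ := hY v hv hr
      exact ⟨some ⟨e, ⟨hv, hr⟩, ht⟩, rfl⟩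
  prob_pos := fun e h => absurd h (G.hatOwner_ne_random Y c _)
  prob_sum := fun v h => absurd h (G.hatOwner_ne_random Y c v)

theorem hat_isBW
    (hY : ∀ v ∈ Y, G.owner v ≠ BWROwner.random → ∃ e, G.src e = v ∧ G.tgt e ∈ Y)
    (c : Bool) (x : ℝ) : (G.hat Y hY c x).IsBW :=
  G.hatOwner_ne_random Y c

end Parametrized

end BWRGame

/-! Existence of a uniformly optimal pair follows by vanishing discount. For each discount factor `β
< 1` the dynamic programming operator is a contraction, and arcs that are optimal for its fixed
point form a saddle point of the discounted game. There are finitely many pairs of strategies, so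
one pair is a saddle point for infinitely many `β` tending to `1`. Plays of a BW-game are eventually
periodic, so normalized discounted payoffs tend to mean payoffs (`HasBoundedMean.tendsto_abel`), and
this pair is uniformly optimal.

For the dependence on `x`, fix `v` and a pair of strategies. If the play reaches `w`, its payoff is
`x`; otherwise its payoff does not depend on `x`. Which case occurs does not depend on `x` either.
So the value is a sup-inf `f x` of a table whose entries are `x` or constants. By
`parametricValue_eq`, between two parameters `lo ≤ hi` it is `x` clamped to `[f lo, f hi]`. The
parameters `⊥, ⊤` and `-R, R` give the two halves of the theorem. -/

/-! ### Cesàro and Abel means of eventually periodic sequences -/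

/-- `a` has mean `c`, with partial sums deviating from the linear growth by at most `M`. -/
def HasBoundedMean (a : ℕ → ℝ) (c M : ℝ) : Prop :=
  ∀ n, |∑ i ∈ Finset.range n, (a i - c)| ≤ M

/-- Subtracting the average over one period makes the sum over a period zero, so the partial sums
are themselves periodic from `N` on and take finitely many values. -/
theorem exists_hasBoundedMean {a : ℕ → ℝ} {N p : ℕ} (hp : 0 < p)
    (ha : ∀ n, N ≤ n → a (n + p) = a n) :
    ∃ M, HasBoundedMean a ((∑ i ∈ Finset.range p, a (N + i)) / p) M := by
  set c := (∑ i ∈ Finset.range p, a (N + i)) / p with hc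
  have hp' : (p : ℝ) ≠ 0 := by positivity
  let S : ℕ → ℝ := fun n => ∑ i ∈ Finset.range n, (a i - c)
  have hS : ∀ k, S (N + k + p) = S (N + k) := by
    intro k
    induction k with
    | zero =>
      simp only [S, add_zero, Finset.sum_range_add, Finset.sum_sub_distrib, Finset.sum_const,
        Finset.card_range, nsmul_eq_mul]
      have : ∑ i ∈ Finset.range p, a (N + i) = p * c := by rw [hc]; field_simp
      push_cast
      linarith
    | succ k ih =>
      have h1 : S (N + (k + 1) + p) = S (N + k + p) + (a (N + k + p) - c) := by
        have : N + (k + 1) + p = (N + k + p) + 1 := by ring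
        rw [this]; exact Finset.sum_range_succ _ _
      have h2 : S (N + (k + 1)) = S (N + k) + (a (N + k) - c) := Finset.sum_range_succ _ _
      rw [h1, h2, ih, ha _ (by omega)]
  have hbase : ∀ n, ∃ m < N + p, S n = S m := by
    intro n
    induction n using Nat.strong_induction_on with
    | _ n ih =>
      by_cases hn : n < N + p
      · exact ⟨n, hn, rfl⟩
      · obtain ⟨m, hm, h⟩ := ih (n - p) (by omega)
        refine ⟨m, hm, ?_⟩
        have := hS (n - p - N)
        rw [show N + (n - p - N) = n - p by omega, show n - p + p = n by omega] at this
        rw [this, h]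
  refine ⟨∑ m ∈ Finset.range (N + p), |S m|, fun n => ?_⟩
  obtain ⟨m, hm, h⟩ := hbase n
  change |S n| ≤ _
  rw [h]
  exact Finset.single_le_sum (f := fun m => |S m|) (fun _ _ => abs_nonneg _) (by simpa using hm)

namespace HasBoundedMean

variable {a : ℕ → ℝ} {c M : ℝ}

theorem tendsto_cesaro (h : HasBoundedMean a c M) :
    Filter.Tendsto (fun T : ℕ => (∑ i ∈ Finset.range (T + 1), a i) / ((T : ℝ) + 1))
      Filter.atTop (nhds c) := by
  rw [tendsto_iff_dist_tendsto_zero]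
  refine squeeze_zero (fun _ => dist_nonneg) (fun T => ?_)
    (tendsto_const_div_atTop_nhds_zero_nat M |>.comp (Filter.tendsto_add_atTop_nat 1))
  have hT : (0 : ℝ) < (T : ℝ) + 1 := by positivity
  have := h (T + 1)
  simp only [Finset.sum_sub_distrib, Finset.sum_const, Finset.card_range, nsmul_eq_mul] at this
  push_cast at this
  rw [Real.dist_eq, Function.comp_apply]
  push_cast
  rw [show (∑ i ∈ Finset.range (T + 1), a i) / ((T : ℝ) + 1) - c
    = (∑ i ∈ Finset.range (T + 1), a i - ((T : ℝ) + 1) * c) / ((T : ℝ) + 1) by field_simp,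
    abs_div, abs_of_pos hT]
  gcongr

/-- Summation by parts: with `S` the partial sums of `a - c`, the difference is `(1 - β)² ∑ βⁱ S (i
+ 1)`, and `|S| ≤ M`. -/
theorem abs_abel_sub_le (h : HasBoundedMean a c M) {β : ℝ}
    (h0 : 0 ≤ β) (h1 : β < 1) : |(1 - β) * ∑' i, β ^ i * a i - c| ≤ (1 - β) * M := by
  have hgeo := summable_geometric_of_lt_one h0 h1
  have hsum : ∀ (g : ℕ → ℝ) (K : ℝ), (∀ i, |g i| ≤ K) → Summable fun i => β ^ i * g i := by
    intro g K hg
    refine Summable.of_norm_bounded (hgeo.mul_right K) fun i => ?_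
    rw [norm_mul, norm_pow, Real.norm_of_nonneg h0]
    exact mul_le_mul_of_nonneg_left (hg i) (pow_nonneg h0 i)
  let S : ℕ → ℝ := fun n => ∑ i ∈ Finset.range n, (a i - c)
  have hS : ∀ n, S (n + 1) = S n + (a n - c) := fun n => Finset.sum_range_succ _ _
  have sS := hsum S M h
  have sS' := hsum (fun n => S (n + 1)) M fun n => h (n + 1)
  have e1 : ∑' i, β ^ i * S i = β * ∑' i, β ^ i * S (i + 1) := by
    rw [sS.tsum_eq_zero_add, ← tsum_mul_left]
    simp only [S, Finset.range_zero, Finset.sum_empty, mul_zero, zero_add]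
    exact tsum_congr fun i => by ring
  have e2 : ∑' i, β ^ i * a i = ∑' i, β ^ i * S (i + 1) - ∑' i, β ^ i * S i
      + (∑' i, β ^ i) * c := by
    rw [← tsum_mul_right, ← sS'.tsum_sub sS, ← (sS'.sub sS).tsum_add (hgeo.mul_right c)]
    exact tsum_congr fun i => by rw [hS]; ring
  have e3 : |∑' i, β ^ i * S (i + 1)| ≤ M * (1 - β)⁻¹ := by
    rw [← tsum_geometric_of_lt_one h0 h1, ← tsum_mul_left]
    refine (norm_tsum_le_tsum_norm sS'.norm).trans (sS'.norm.tsum_le_tsum (fun i => ?_)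
      (hgeo.mul_left M))
    rw [norm_mul, norm_pow, Real.norm_of_nonneg h0, mul_comm]
    exact mul_le_mul_of_nonneg_right (h (i + 1)) (pow_nonneg h0 i)
  have hpos : 0 < 1 - β := sub_pos.2 h1
  rw [e2, e1, tsum_geometric_of_lt_one h0 h1]
  rw [show (1 - β) * (∑' i, β ^ i * S (i + 1) - β * ∑' i, β ^ i * S (i + 1) + (1 - β)⁻¹ * c) - c
    = (1 - β) * ((1 - β) * ∑' i, β ^ i * S (i + 1)) by field_simp; ring,
    abs_mul, abs_mul, abs_of_pos hpos]
  refine mul_le_mul_of_nonneg_left ?_ hpos.le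
  calc (1 - β) * |∑' i, β ^ i * S (i + 1)| ≤ (1 - β) * (M * (1 - β)⁻¹) := by gcongr
    _ = M := by field_simp

theorem tendsto_abel (h : HasBoundedMean a c M) {β : ℕ → ℝ}
    (h0 : ∀ n, 0 ≤ β n) (h1 : ∀ n, β n < 1) (hβ : Filter.Tendsto β Filter.atTop (nhds 1)) :
    Filter.Tendsto (fun n => (1 - β n) * ∑' i, β n ^ i * a i) Filter.atTop (nhds c) := by
  rw [tendsto_iff_dist_tendsto_zero]
  refine squeeze_zero (fun _ => dist_nonneg)
    (fun n => h.abs_abel_sub_le (h0 n) (h1 n)) ?_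
  simpa using (tendsto_const_nhds (x := (1 : ℝ)).sub hβ).mul_const M

end HasBoundedMean

/-! ### Plays of a BW-game are deterministic -/

namespace BWRGame

section BW

variable {V E : Type*} [Fintype E] (G : BWRGame V E)

variable {G} in
theorem IsBW.black_of_not_white (h : G.IsBW) {v : V} (hw : ¬ G.owner v = BWROwner.white) :
    G.owner v = BWROwner.black := by
  have := h v
  cases h' : G.owner v <;> simp_all

open Classical in
/-- The arc taken at `v` in a situation of a BW-game. -/
noncomputable def move (h : G.IsBW) (sW : G.WhiteStrategy) (sB : G.BlackStrategy) (v : V) :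
    {e : E // G.src e = v} :=
  if hw : G.owner v = BWROwner.white then sW ⟨v, hw⟩ else sB ⟨v, h.black_of_not_white hw⟩

/-- The position that follows `v` in a situation of a BW-game. -/
noncomputable def next (h : G.IsBW) (sW : G.WhiteStrategy) (sB : G.BlackStrategy) (v : V) : V :=
  G.tgt (G.move h sW sB v).1

variable {G}
variable (sW : G.WhiteStrategy) (sB : G.BlackStrategy)

theorem move_of_white (h : G.IsBW) {v : V} (hw : G.owner v = BWROwner.white) :
    G.move h sW sB v = sW ⟨v, hw⟩ :=
  dif_pos hw

theorem move_of_black (h : G.IsBW) {v : V} (hb : G.owner v = BWROwner.black) :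
    G.move h sW sB v = sB ⟨v, hb⟩ :=
  dif_neg (by simp [hb])

open Classical in
theorem arcProb_of_src_eq (h : G.IsBW) {v : V} {e : E} (he : G.src e = v) :
    G.arcProb sW sB e = if (G.move h sW sB v).1 = e then 1 else 0 := by
  subst he
  unfold arcProb
  by_cases hw : G.owner (G.src e) = BWROwner.white
  · rw [dif_pos hw, move_of_white sW sB h hw]
  · have hb := h.black_of_not_white hw
    rw [dif_neg hw, dif_pos hb, move_of_black sW sB h hb]

open Classical in
theorem sum_arcProb_mul (h : G.IsBW) (v : V) (g : E → ℝ) :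
    ∑ e with G.src e = v, G.arcProb sW sB e * g e = g (G.move h sW sB v).1 := by
  rw [Finset.sum_eq_single (G.move h sW sB v).1]
  · rw [arcProb_of_src_eq sW sB h (G.move h sW sB v).2]; simp
  · intro e he hne
    rw [arcProb_of_src_eq sW sB h (Finset.mem_filter.1 he).2, if_neg hne.symm, zero_mul]
  · intro hn
    simp [(G.move h sW sB v).2] at hn

theorem stepReward_eq (h : G.IsBW) (v : V) : G.stepReward sW sB v = G.reward (G.move h sW sB v).1 :=
  sum_arcProb_mul sW sB h v G.reward

variable [Fintype V]

theorem transition_mulVec (h : G.IsBW) (g : V → ℝ) :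
    Matrix.mulVec (G.transition sW sB) g = g ∘ G.next h sW sB := by
  classical
  funext v
  change ∑ u, G.transition sW sB v u * g u = _
  rw [Function.comp_apply, next, ← sum_arcProb_mul sW sB h v (fun e => g (G.tgt e)),
    ← Finset.sum_fiberwise (s := Finset.univ.filter fun e => G.src e = v) (g := G.tgt)]
  refine Finset.sum_congr rfl fun u _ => ?_
  rw [transition, Finset.sum_mul, Finset.filter_filter]
  refine Finset.sum_congr (by ext; simp) fun e he => ?_
  rw [(Finset.mem_filter.1 he).2.2]

theorem expectedReward_eq (h : G.IsBW) (v : V) (i : ℕ) :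
    G.expectedReward sW sB v i
      = G.reward (G.move h sW sB ((G.next h sW sB)^[i] v)).1 := by
  classical
  have key : ∀ i, ∀ g : V → ℝ,
      Matrix.mulVec (G.transition sW sB ^ i) g = g ∘ (G.next h sW sB)^[i] := by
    intro i
    induction i with
    | zero => intro g; simp
    | succ i ih =>
      intro g
      rw [pow_succ, ← Matrix.mulVec_mulVec, transition_mulVec sW sB h, ih, Function.iterate_succ']
      rfl
  unfold expectedReward
  rw [← stepReward_eq sW sB h, show (G.stepReward sW sB ((G.next h sW sB)^[i] v))
    = (G.stepReward sW sB ∘ (G.next h sW sB)^[i]) v from rfl, ← key]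

theorem payoff_eq_of_hasBoundedMean {v : V} {c M : ℝ}
    (hm : HasBoundedMean (G.expectedReward sW sB v) c M) : G.payoff sW sB v = c :=
  hm.tendsto_cesaro.liminf_eq

/-- By pigeonhole the play visits some position at two times `i < j`; from time `i` on it has period
`j - i`. -/
theorem exists_hasBoundedMean_payoff (h : G.IsBW) (v : V) :
    ∃ M, HasBoundedMean (G.expectedReward sW sB v) (G.payoff sW sB v) M := by
  obtain ⟨i, j, hij, hne⟩ : ∃ i j, i < j ∧
      (G.next h sW sB)^[i] v = (G.next h sW sB)^[j] v := by
    obtain ⟨i, j, hne, he⟩ :=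
      Finite.exists_ne_map_eq_of_infinite (fun i => (G.next h sW sB)^[i] v)
    rcases hne.lt_or_gt with hlt | hlt
    · exact ⟨i, j, hlt, he⟩
    · exact ⟨j, i, hlt, he.symm⟩
  obtain ⟨M, hM⟩ := exists_hasBoundedMean (a := G.expectedReward sW sB v) (N := i) (p := j - i)
    (by omega) (by
      intro n hn
      rw [expectedReward_eq sW sB h, expectedReward_eq sW sB h]
      suffices hs : (G.next h sW sB)^[n + (j - i)] v = (G.next h sW sB)^[n] v by rw [hs]
      rw [show n + (j - i) = (n - i) + j by omega, Function.iterate_add_apply, ← hne,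
        ← Function.iterate_add_apply, show n - i + i = n by omega])
  refine ⟨M, ?_⟩
  rwa [payoff_eq_of_hasBoundedMean sW sB hM]

theorem abs_expectedReward_le (h : G.IsBW) {R : ℝ} (hR : ∀ e, |G.reward e| ≤ R) (v : V) (i : ℕ) :
    |G.expectedReward sW sB v i| ≤ R := by
  rw [expectedReward_eq sW sB h]; exact hR _

theorem abs_payoff_le (h : G.IsBW) {R : ℝ} (hR : ∀ e, |G.reward e| ≤ R) (v : V) :
    |G.payoff sW sB v| ≤ R := by
  obtain ⟨M, hM⟩ := exists_hasBoundedMean_payoff sW sB h v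
  refine le_of_tendsto hM.tendsto_cesaro.abs (Filter.Eventually.of_forall fun T => ?_)
  have hT : (0 : ℝ) < (T : ℝ) + 1 := by positivity
  rw [abs_div, abs_of_pos hT, div_le_iff₀ hT]
  refine (Finset.abs_sum_le_sum_abs _ _).trans
    ((Finset.sum_le_card_nsmul _ _ R fun i _ => abs_expectedReward_le sW sB h hR v i).trans ?_)
  simp [mul_comm]

end BW

end BWRGame

/-! ### Discounted games and the existence of uniformly optimal pairs -/

namespace BWRGame

section Discounted

variable {V E : Type*} [Fintype E] (G : BWRGame V E)

/-- The reward of the arc `e` plus the discounted continuation value `u` at its end. -/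
def arcValue (β : ℝ) (u : V → ℝ) (e : E) : ℝ := G.reward e + β * u (G.tgt e)

theorem exists_best_arc (β : ℝ) (u : V → ℝ) (v : V) : ∃ e : {e : E // G.src e = v},
    (G.owner v = BWROwner.white → ∀ e', G.src e' = v → G.arcValue β u e' ≤ G.arcValue β u e) ∧
    (G.owner v = BWROwner.black → ∀ e', G.src e' = v →
      G.arcValue β u e ≤ G.arcValue β u e') := by
  have : Nonempty {e : E // G.src e = v} := nonempty_subtype.2 (G.exists_arc v)
  by_cases hw : G.owner v = BWROwner.white
  · obtain ⟨e, he⟩ := Finite.exists_max fun e : {e : E // G.src e = v} => G.arcValue β u e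
    exact ⟨e, fun _ e' h => he ⟨e', h⟩, fun hb => by simp [hw] at hb⟩
  · obtain ⟨e, he⟩ := Finite.exists_min fun e : {e : E // G.src e = v} => G.arcValue β u e
    exact ⟨e, fun hw' => absurd hw' hw, fun _ e' h => he ⟨e', h⟩⟩

/-- An arc that is optimal for the owner of `v` with respect to continuation values `u`. -/
noncomputable def bestArc (β : ℝ) (u : V → ℝ) (v : V) : {e : E // G.src e = v} :=
  (G.exists_best_arc β u v).choose

/-- The dynamic programming operator of the discounted BW-game. -/
noncomputable def shapley (β : ℝ) (u : V → ℝ) (v : V) : ℝ := G.arcValue β u (G.bestArc β u v)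

variable {G}

theorem arcValue_le_shapley {β : ℝ} {u : V → ℝ} {v : V} (hw : G.owner v = BWROwner.white)
    {e : E} (he : G.src e = v) : G.arcValue β u e ≤ G.shapley β u v :=
  (G.exists_best_arc β u v).choose_spec.1 hw e he

theorem shapley_le_arcValue {β : ℝ} {u : V → ℝ} {v : V} (hb : G.owner v = BWROwner.black)
    {e : E} (he : G.src e = v) : G.shapley β u v ≤ G.arcValue β u e :=
  (G.exists_best_arc β u v).choose_spec.2 hb e he

variable [Fintype V]

theorem arcValue_sub_le {β : ℝ} (h0 : 0 ≤ β) (u u' : V → ℝ) (e : E) :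
    G.arcValue β u e - G.arcValue β u' e ≤ β * dist u u' := by
  have h1 : u (G.tgt e) - u' (G.tgt e) ≤ dist u u' :=
    (le_abs_self _).trans (dist_le_pi_dist u u' (G.tgt e))
  calc G.arcValue β u e - G.arcValue β u' e = β * (u (G.tgt e) - u' (G.tgt e)) := by
        unfold arcValue; ring
    _ ≤ β * dist u u' := mul_le_mul_of_nonneg_left h1 h0

theorem shapley_sub_le (h : G.IsBW) {β : ℝ} (h0 : 0 ≤ β) (u u' : V → ℝ) (v : V) :
    G.shapley β u v - G.shapley β u' v ≤ β * dist u u' := by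
  by_cases hw : G.owner v = BWROwner.white
  · have h1 := arcValue_le_shapley (β := β) (u := u') hw (G.bestArc β u v).2
    have h2 := arcValue_sub_le (G := G) h0 u u' (G.bestArc β u v).1
    unfold shapley at *
    linarith
  · have h1 := shapley_le_arcValue (β := β) (u := u) (h.black_of_not_white hw)
      (G.bestArc β u' v).2
    have h2 := arcValue_sub_le (G := G) h0 u u' (G.bestArc β u' v).1
    unfold shapley at *
    linarith

theorem exists_shapley_fixedPoint (h : G.IsBW) {β : ℝ} (h0 : 0 ≤ β) (h1 : β < 1) :
    ∃ u, G.shapley β u = u := by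
  have hc : ContractingWith ⟨β, h0⟩ (G.shapley β) := by
    refine ⟨by exact_mod_cast h1, LipschitzWith.of_dist_le_mul fun u u' => ?_⟩
    refine (dist_pi_le_iff (mul_nonneg h0 dist_nonneg)).2 fun v => abs_sub_le_iff.2 ⟨?_, ?_⟩
    · exact shapley_sub_le h h0 u u' v
    · exact (shapley_sub_le h h0 u' u v).trans_eq (by rw [dist_comm])
  exact ⟨_, hc.fixedPoint_isFixedPt⟩

/-- The discounted payoff of a situation. -/
noncomputable def discounted (sW : G.WhiteStrategy) (sB : G.BlackStrategy) (β : ℝ) (v : V) : ℝ :=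
  ∑' i, β ^ i * G.expectedReward sW sB v i

/-- A terminal payment `u` after `n` steps has vanishing weight. Including it makes the truncated
payoffs equal to `u v` at `n = 0` and monotone in `n` under the one-step inequalities used below. -/
theorem tendsto_discounted_partial (h : G.IsBW) (sW : G.WhiteStrategy) (sB : G.BlackStrategy)
    {β : ℝ} (h0 : 0 ≤ β) (h1 : β < 1) (u : V → ℝ) (v : V) :
    Filter.Tendsto (fun n => ∑ i ∈ Finset.range n, β ^ i * G.expectedReward sW sB v i
      + β ^ n * u ((G.next h sW sB)^[n] v)) Filter.atTop (nhds (discounted sW sB β v)) := by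
  have hs : Summable fun i => β ^ i * G.expectedReward sW sB v i := by
    obtain ⟨K, hK⟩ := Finite.exists_le fun e => |G.reward e|
    refine Summable.of_norm_bounded ((summable_geometric_of_lt_one h0 h1).mul_right K) fun i => ?_
    rw [norm_mul, norm_pow, Real.norm_of_nonneg h0]
    exact mul_le_mul_of_nonneg_left (abs_expectedReward_le sW sB h hK v i) (pow_nonneg h0 i)
  have hz : Filter.Tendsto (fun n => β ^ n * u ((G.next h sW sB)^[n] v)) Filter.atTop
      (nhds 0) := by
    obtain ⟨K, hK⟩ := Finite.exists_le fun v => ‖u v‖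
    exact (tendsto_pow_atTop_nhds_zero_of_lt_one h0 h1).zero_mul_isBoundedUnder_le
      (Filter.isBoundedUnder_of ⟨K, fun n => hK _⟩)
  simpa [discounted] using hs.hasSum.tendsto_sum_nat.add hz

theorem discounted_le (h : G.IsBW) {sW : G.WhiteStrategy} {sB : G.BlackStrategy}
    {β : ℝ} (h0 : 0 ≤ β) (h1 : β < 1) {u : V → ℝ}
    (hu : ∀ v, G.arcValue β u (G.move h sW sB v).1 ≤ u v) (v : V) :
    discounted sW sB β v ≤ u v := by
  refine le_of_tendsto (tendsto_discounted_partial h sW sB h0 h1 u v)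
    (Filter.Eventually.of_forall fun n => ?_)
  induction n with
  | zero => simp
  | succ n ih =>
    refine le_trans ?_ ih
    have := mul_le_mul_of_nonneg_left (hu ((G.next h sW sB)^[n] v)) (pow_nonneg h0 n)
    rw [Finset.sum_range_succ, Function.iterate_succ_apply', expectedReward_eq sW sB h]
    unfold arcValue at this
    rw [next]
    rw [mul_add, ← mul_assoc, ← pow_succ] at this
    linarith

theorem le_discounted (h : G.IsBW) {sW : G.WhiteStrategy} {sB : G.BlackStrategy}
    {β : ℝ} (h0 : 0 ≤ β) (h1 : β < 1) {u : V → ℝ}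
    (hu : ∀ v, u v ≤ G.arcValue β u (G.move h sW sB v).1) (v : V) :
    u v ≤ discounted sW sB β v := by
  refine ge_of_tendsto (tendsto_discounted_partial h sW sB h0 h1 u v)
    (Filter.Eventually.of_forall fun n => ?_)
  induction n with
  | zero => simp
  | succ n ih =>
    refine ih.trans ?_
    have := mul_le_mul_of_nonneg_left (hu ((G.next h sW sB)^[n] v)) (pow_nonneg h0 n)
    rw [Finset.sum_range_succ, Function.iterate_succ_apply', expectedReward_eq sW sB h]
    unfold arcValue at this
    rw [next]
    rw [mul_add, ← mul_assoc, ← pow_succ] at this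
    linarith

/-- Discounted BW-games have saddle points in pure stationary strategies. -/
theorem exists_discounted_saddle (h : G.IsBW) {β : ℝ} (h0 : 0 ≤ β) (h1 : β < 1) :
    ∃ s : G.WhiteStrategy × G.BlackStrategy, ∀ tW tB v,
      discounted tW s.2 β v ≤ discounted s.1 s.2 β v ∧
      discounted s.1 s.2 β v ≤ discounted s.1 tB β v := by
  obtain ⟨u, hu⟩ := exists_shapley_fixedPoint h h0 h1
  let sW : G.WhiteStrategy := fun v => G.bestArc β u v.1
  let sB : G.BlackStrategy := fun v => G.bestArc β u v.1
  -- One-step check against the fixed point: at a white position no arc beats the best one, and at a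
  -- black position `sB` plays the best arc, which gives equality.
  have hW : ∀ tW v, discounted tW sB β v ≤ u v := fun tW => discounted_le h h0 h1 fun v => by
    conv_rhs => rw [← hu]
    by_cases hw : G.owner v = BWROwner.white
    · exact arcValue_le_shapley hw (G.move h tW sB v).2
    · rw [move_of_black tW sB h (h.black_of_not_white hw)]
      exact le_rfl
  have hB : ∀ tB v, u v ≤ discounted sW tB β v := fun tB => le_discounted h h0 h1 fun v => by
    conv_lhs => rw [← hu]
    by_cases hw : G.owner v = BWROwner.white
    · rw [move_of_white sW tB h hw]
      exact le_rfl
    · exact shapley_le_arcValue (h.black_of_not_white hw) (G.move h sW tB v).2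
  exact ⟨(sW, sB), fun tW tB v =>
    ⟨(hW tW v).trans (hB sB v), (hW sW v).trans (hB tB v)⟩⟩

/-- BW-games have uniformly optimal pairs of pure stationary strategies. -/
theorem exists_isUniformlyOptimal (h : G.IsBW) :
    ∃ sW sB, G.IsUniformlyOptimal sW sB := by
  let β : ℕ → ℝ := fun n => 1 - 1 / ((n : ℝ) + 1)
  have h0 : ∀ n, 0 ≤ β n := fun n => by
    have : 1 / ((n : ℝ) + 1) ≤ 1 := by
      rw [div_le_one (by positivity)]; linarith [n.cast_nonneg (α := ℝ)]
    simpa [β] using this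
  have h1 : ∀ n, β n < 1 := fun n => sub_lt_self _ (by positivity)
  have hβ : Filter.Tendsto β Filter.atTop (nhds 1) := by
    simpa [β] using tendsto_const_nhds (x := (1 : ℝ)).sub tendsto_one_div_add_atTop_nhds_zero_nat
  have hlim : ∀ sW sB v, Filter.Tendsto (fun n => (1 - β n) * discounted sW sB (β n) v)
      Filter.atTop (nhds (G.payoff sW sB v)) := fun sW sB v => by
    obtain ⟨M, hM⟩ := exists_hasBoundedMean_payoff sW sB h v
    exact hM.tendsto_abel h0 h1 hβ
  choose s hs using fun n => exists_discounted_saddle h (h0 n) (h1 n)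
  have : Finite (G.WhiteStrategy × G.BlackStrategy) := inferInstance
  -- The saddle inequalities of `p` hold for infinitely many `n`, which is enough to pass to limits
  -- that exist along the whole sequence.
  obtain ⟨p, hp⟩ := Finite.exists_infinite_fiber s
  have hfr : ∃ᶠ n in Filter.atTop, s n = p :=
    Nat.frequently_atTop_iff_infinite.2 (Set.infinite_coe_iff.1 hp)
  refine ⟨p.1, p.2, fun tW tB v => ⟨?_, ?_⟩⟩
  · refine le_of_tendsto_of_tendsto_of_frequently (hlim _ _ v) (hlim _ _ v) (hfr.mono ?_)
    rintro n rfl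
    exact mul_le_mul_of_nonneg_left (hs n tW tB v).1 (sub_nonneg.2 (h1 n).le)
  · refine le_of_tendsto_of_tendsto_of_frequently (hlim _ _ v) (hlim _ _ v) (hfr.mono ?_)
    rintro n rfl
    exact mul_le_mul_of_nonneg_left (hs n tW tB v).2 (sub_nonneg.2 (h1 n).le)

end Discounted

end BWRGame

/-! ### Saddle values of tables with one parameter -/

/-- The saddle value of a family of payoffs each of which is either a parameter `t` (the pairs
in `D`) or a constant. -/
noncomputable def parametricValue {A B : Type*} (D : A → B → Prop) (k : A → B → EReal)
    (t : EReal) : EReal :=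
  open Classical in ⨆ a, ⨅ b, if D a b then t else k a b

section ParametricValue

variable {A B : Type*} (D : A → B → Prop) (k : A → B → EReal)

theorem parametricValue_mono : Monotone (parametricValue D k) := by
  classical
  intro s t hst
  refine iSup_mono fun a => iInf_mono fun b => ?_
  split_ifs
  exacts [hst, le_rfl]

/-- A row with an entry in `D` has infimum at most `x`, and at most the value at `hi` by
monotonicity; a row without one is the same at `lo`. Conversely, cutting a row at `hi` down by `x`
stays below that row at `x`, and suprema distribute over `⊓ x`. -/
theorem parametricValue_eq {lo hi x : EReal} (hlo : lo ≤ x) (hhi : x ≤ hi) :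
    parametricValue D k x = (parametricValue D k hi ⊓ x) ⊔ parametricValue D k lo := by
  classical
  refine le_antisymm (iSup_le fun a => ?_)
    (sup_le ?_ (parametricValue_mono D k hlo))
  · by_cases hD : ∃ b, D a b
    · obtain ⟨b, hb⟩ := hD
      refine le_sup_of_le_left (le_inf ?_ ((iInf_le _ b).trans_eq (if_pos hb)))
      refine le_trans ?_ (parametricValue_mono D k hhi)
      exact le_iSup (fun a => ⨅ b, if D a b then x else k a b) a
    · push Not at hD
      refine le_sup_of_le_right ?_
      refine le_trans (le_of_eq ?_) (le_iSup (fun a => ⨅ b, if D a b then lo else k a b) a)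
      simp only [hD, if_false]
  · unfold parametricValue
    rw [iSup_inf_eq]
    refine iSup_mono fun a => le_iInf fun b => ?_
    by_cases hb : D a b
    · rw [if_pos hb]
      exact inf_le_right
    · rw [if_neg hb]
      exact inf_le_left.trans ((iInf_le _ b).trans_eq (if_neg hb))

theorem parametricValue_eq_of_saddle {m t : EReal} {a₀ : A} {b₀ : B}
    (h₁ : ∀ a, (D a b₀ → t ≤ m) ∧ (¬ D a b₀ → k a b₀ ≤ m))
    (h₂ : ∀ b, (D a₀ b → m ≤ t) ∧ (¬ D a₀ b → m ≤ k a₀ b)) :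
    parametricValue D k t = m := by
  classical
  refine le_antisymm (iSup_le fun a => (iInf_le _ b₀).trans ?_)
    (le_iSup_of_le a₀ (le_iInf fun b => ?_))
  · split_ifs with h
    exacts [(h₁ a).1 h, (h₁ a).2 h]
  · split_ifs with h
    exacts [(h₂ b).1 h, (h₂ b).2 h]

end ParametricValue

/-! ### The value of the parametrized game as a function of `x` -/

namespace BWRGame

section HatValue

variable {V E : Type*} [Fintype E] (G : BWRGame V E) (Y : Set V)
  (hY : ∀ v ∈ Y, G.owner v ≠ BWROwner.random → ∃ e, G.src e = v ∧ G.tgt e ∈ Y) (c : Bool)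

theorem hat_arc_of_src_eq_none {e : G.HatArc Y} (he : G.hatSrc Y e = none) : e = none := by
  cases e with
  | none => rfl
  | some e => simp [hatSrc] at he

/-- Only the reward of the loop at `w` depends on the parameter. Owners and arcs do not, so
strategies for parameter `0` serve definitionally for every `x`. -/
theorem hat_reward_move (x x' : ℝ) (sW : (G.hat Y hY c 0).WhiteStrategy)
    (sB : (G.hat Y hY c 0).BlackStrategy) {u : G.HatPos Y} (hu : u ≠ none) :
    (G.hat Y hY c x).reward ((G.hat Y hY c x).move (G.hat_isBW Y hY c x) sW sB u).1
      = (G.hat Y hY c x').reward ((G.hat Y hY c x').move (G.hat_isBW Y hY c x') sW sB u).1 := by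
  change G.hatReward Y x ((G.hat Y hY c 0).move (G.hat_isBW Y hY c 0) sW sB u).1
    = G.hatReward Y x' ((G.hat Y hY c 0).move (G.hat_isBW Y hY c 0) sW sB u).1
  obtain ⟨e, he⟩ := (G.hat Y hY c 0).move (G.hat_isBW Y hY c 0) sW sB u
  cases e with
  | none => exact absurd he.symm hu
  | some e => rfl

theorem hat_move_none (x : ℝ) (sW : (G.hat Y hY c x).WhiteStrategy)
    (sB : (G.hat Y hY c x).BlackStrategy) :
    ((G.hat Y hY c x).move (G.hat_isBW Y hY c x) sW sB none).1 = none :=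
  G.hat_arc_of_src_eq_none Y ((G.hat Y hY c x).move (G.hat_isBW Y hY c x) sW sB none).2

variable [Fintype V]

/-- The play from `v` reaches the position `w` of the parametrized BW-game. -/
def HatReaches (v : G.HatPos Y) (sW : (G.hat Y hY c 0).WhiteStrategy)
    (sB : (G.hat Y hY c 0).BlackStrategy) : Prop :=
  ∃ i, ((G.hat Y hY c 0).next (G.hat_isBW Y hY c 0) sW sB)^[i] v = none

variable {G Y hY c}

theorem HatReaches.payoff_eq {v : G.HatPos Y} {sW : (G.hat Y hY c 0).WhiteStrategy}
    {sB : (G.hat Y hY c 0).BlackStrategy} (h : G.HatReaches Y hY c v sW sB) (x : ℝ) :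
    (G.hat Y hY c x).payoff sW sB v = x := by
  obtain ⟨N, hN⟩ := h
  have hstep : (G.hat Y hY c x).next (G.hat_isBW Y hY c x) sW sB none = none :=
    congrArg (G.hatTgt Y) (G.hat_move_none Y hY c x sW sB)
  have hr : ∀ n, N ≤ n → (G.hat Y hY c x).expectedReward sW sB v n = x := by
    intro n hn
    have hpos : ((G.hat Y hY c x).next (G.hat_isBW Y hY c x) sW sB)^[n] v = none := by
      obtain ⟨k, rfl⟩ := Nat.exists_eq_add_of_le' hn
      rw [Function.iterate_add_apply]
      exact (congrArg _ hN).trans (Function.iterate_fixed hstep k)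
    refine (expectedReward_eq (G := G.hat Y hY c x) sW sB (G.hat_isBW Y hY c x) v n).trans ?_
    rw [hpos]
    exact congrArg (G.hatReward Y x) (G.hat_move_none Y hY c x sW sB)
  obtain ⟨M, hM⟩ := exists_hasBoundedMean (a := (G.hat Y hY c x).expectedReward sW sB v)
    (N := N) one_pos (fun n hn => by rw [hr _ (by omega), hr _ hn])
  refine (payoff_eq_of_hasBoundedMean (G := G.hat Y hY c x) sW sB hM).trans ?_
  simp [hr]

theorem payoff_eq_of_not_hatReaches {v : G.HatPos Y} {sW : (G.hat Y hY c 0).WhiteStrategy}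
    {sB : (G.hat Y hY c 0).BlackStrategy} (h : ¬ G.HatReaches Y hY c v sW sB) (x : ℝ) :
    (G.hat Y hY c x).payoff sW sB v = (G.hat Y hY c 0).payoff sW sB v := by
  have : (G.hat Y hY c x).expectedReward sW sB v = (G.hat Y hY c 0).expectedReward sW sB v := by
    funext n
    refine (expectedReward_eq (G := G.hat Y hY c x) sW sB (G.hat_isBW Y hY c x) v n).trans
      (Eq.trans ?_
        (expectedReward_eq (G := G.hat Y hY c 0) sW sB (G.hat_isBW Y hY c 0) v n).symm)
    exact hat_reward_move G Y hY c x 0 sW sB fun hn => h ⟨n, hn⟩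
  unfold payoff
  rw [this]

variable (G Y hY c)

/-- The value of the parametrized BW-game from `v`, for an extended real parameter. -/
noncomputable def hatValue (v : G.HatPos Y) : EReal → EReal :=
  parametricValue (G.HatReaches Y hY c v)
    fun sW sB => (((G.hat Y hY c 0).payoff sW sB v : ℝ) : EReal)

variable {G Y hY c}

/-- A uniformly optimal pair at `x` is a saddle point of the table at `x`, since the entries are
exactly the payoffs from `v`. -/
theorem hatValue_eq {v : G.HatPos Y} {x m : ℝ} (hm : (G.hat Y hY c x).HasValue v m) :
    G.hatValue Y hY c v x = m := by
  obtain ⟨sW, sB, hs, rfl⟩ := hm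
  refine parametricValue_eq_of_saddle (a₀ := sW) (b₀ := sB) _ _
    (fun tW => ⟨fun h => ?_, fun h => ?_⟩) (fun tB => ⟨fun h => ?_, fun h => ?_⟩)
  all_goals rw [EReal.coe_le_coe_iff]
  · exact (h.payoff_eq x).symm.trans_le (hs tW sB v).1
  · exact (payoff_eq_of_not_hatReaches h x).symm.trans_le (hs tW sB v).1
  · exact (hs sW tB v).2.trans_eq (h.payoff_eq x)
  · exact (hs sW tB v).2.trans_eq (payoff_eq_of_not_hatReaches h x)

theorem exists_hat_hasValue (v : G.HatPos Y) (x : ℝ) : ∃ m, (G.hat Y hY c x).HasValue v m := by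
  obtain ⟨sW, sB, h⟩ := exists_isUniformlyOptimal (G.hat_isBW Y hY c x)
  exact ⟨_, sW, sB, h, rfl⟩

theorem abs_le_of_hat_hasValue {v : G.HatPos Y} {x m R : ℝ} (hR : ∀ e, |G.reward e| ≤ R)
    (hx : |x| ≤ R) (hm : (G.hat Y hY c x).HasValue v m) : |m| ≤ R := by
  obtain ⟨sW, sB, -, rfl⟩ := hm
  refine abs_payoff_le sW sB (G.hat_isBW Y hY c x) (fun e => ?_) v
  cases e with
  | none => exact hx
  | some e => exact hR e.1

/-- The three regimes of `(f hi ⊓ x) ⊔ f lo`, the median of `f lo`, `x` and `f hi`. -/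
theorem hatValue_clamp {v : G.HatPos Y} {lo hi x m : EReal} (hlo : lo ≤ x) (hhi : x ≤ hi)
    (hm : G.hatValue Y hY c v x = m) :
    (G.hatValue Y hY c v hi ≤ x → m = G.hatValue Y hY c v hi) ∧
    (x ≤ G.hatValue Y hY c v lo → m = G.hatValue Y hY c v lo) ∧
    (G.hatValue Y hY c v lo ≤ x → x ≤ G.hatValue Y hY c v hi → m = x) := by
  have hmono : Monotone (G.hatValue Y hY c v) := parametricValue_mono _ _
  have hle := hmono (hlo.trans hhi)
  have := (parametricValue_eq _ _ hlo hhi).symm.trans hm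
  change (G.hatValue Y hY c v hi ⊓ x) ⊔ G.hatValue Y hY c v lo = m at this
  rw [← this]
  refine ⟨fun h => ?_, fun h => ?_, fun h h' => ?_⟩
  · rw [inf_eq_left.2 h, sup_eq_left.2 hle]
  · rw [inf_eq_right.2 (h.trans hle), sup_eq_right.2 h]
  · rw [inf_eq_right.2 h', sup_eq_left.2 h]

end HatValue

end BWRGame

theorem mainTheorem6 {V E : Type*} [Fintype V] [Fintype E] (G : BWRGame V E) (Y : Set V)
    (hY : ∀ v ∈ Y, G.owner v ≠ BWROwner.random → ∃ e, G.src e = v ∧ G.tgt e ∈ Y)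
    (c : Bool) (v : G.HatPos Y) :
    (∃ l₁ l₂ : EReal, l₁ ≤ l₂ ∧
      ∀ x : ℝ, ∃ m : ℝ, (G.hat Y hY c x).HasValue v m ∧
        (l₂ ≤ (x : EReal) → (m : EReal) = l₂) ∧
        ((x : EReal) ≤ l₁ → (m : EReal) = l₁) ∧
        (l₁ ≤ (x : EReal) → (x : EReal) ≤ l₂ → m = x)) ∧
    (∀ R : ℝ, 0 ≤ R → (∀ e, |G.reward e| ≤ R) →
      ∃ l₁ l₂ : ℝ, -R ≤ l₁ ∧ l₁ ≤ l₂ ∧ l₂ ≤ R ∧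
        ∀ x ∈ Set.Icc (-R) R, ∃ m : ℝ, (G.hat Y hY c x).HasValue v m ∧
          (l₂ ≤ x → m = l₂) ∧
          (x ≤ l₁ → m = l₁) ∧
          (x ∈ Set.Icc l₁ l₂ → m = x)) := by
  constructor
  -- The upper threshold is `⊤` exactly when some white strategy reaches `w` against every black
  -- one; the lower is `⊥` exactly when every white strategy has a black reply that reaches `w`.
  · refine ⟨G.hatValue Y hY c v ⊥, G.hatValue Y hY c v ⊤,
      parametricValue_mono _ _ bot_le, fun x => ?_⟩
    obtain ⟨m, hm⟩ := BWRGame.exists_hat_hasValue (hY := hY) (c := c) v x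
    obtain ⟨h₁, h₂, h₃⟩ := BWRGame.hatValue_clamp bot_le le_top (BWRGame.hatValue_eq hm)
    exact ⟨m, hm, h₁, h₂, fun h h' => EReal.coe_eq_coe_iff.1 (h₃ h h')⟩
  · intro R hR hr
    -- The thresholds are now the values at `-R` and `R`, which are real and lie in `[-R, R]`
    -- because all local rewards do.
    obtain ⟨l₁, hl₁⟩ := BWRGame.exists_hat_hasValue (hY := hY) (c := c) v (-R)
    obtain ⟨l₂, hl₂⟩ := BWRGame.exists_hat_hasValue (hY := hY) (c := c) v R
    have e₁ := BWRGame.hatValue_eq hl₁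
    have e₂ := BWRGame.hatValue_eq hl₂
    have b₁ := BWRGame.abs_le_of_hat_hasValue hr (by rw [abs_neg, abs_of_nonneg hR]) hl₁
    have b₂ := BWRGame.abs_le_of_hat_hasValue hr (by rw [abs_of_nonneg hR]) hl₂
    refine ⟨l₁, l₂, (abs_le.1 b₁).1, ?_, (abs_le.1 b₂).2, fun x hx => ?_⟩
    · rw [← EReal.coe_le_coe_iff, ← e₁, ← e₂]
      exact parametricValue_mono _ _ (EReal.coe_le_coe_iff.2 (by linarith))
    · obtain ⟨m, hm⟩ := BWRGame.exists_hat_hasValue (hY := hY) (c := c) v x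
      have := BWRGame.hatValue_clamp (EReal.coe_le_coe_iff.2 hx.1) (EReal.coe_le_coe_iff.2 hx.2)
        (BWRGame.hatValue_eq hm)
      rw [e₁, e₂] at this
      simp only [EReal.coe_le_coe_iff, EReal.coe_eq_coe_iff] at this
      exact ⟨m, hm, this.1, this.2.1, fun h => this.2.2 h.1 h.2⟩
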